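/- Let $G$ be a (real, finite-dimensional) Lie group, let $e_1,\dots,e_n$ be a basis of its Lie algebra, regarded as a frame of left-invariant vector fields on $G$, and let $g$ and $\bar g$ be left-invariant pseudo-Riemannian metrics on $G$, of arbitrary signature, represented in this basis by the constant symmetric matrices $S=(g(e_i,e_j))$ and $\bar S=(\bar g(e_i,e_j))$. Let $\nabla$ be the Levi-Civita connection of $g$ and let $\omega=(\omega^j_i)$ be its matrix of connection 1-forms on $G$, defined by $\nabla e_i=\sum_j\omega^j_i\,e_j$ (the upper index is the row index). Say that $\bar g$ is geodesically equivalent to $g$ if every geodesic of $g$ is, after a regular change of parameter, a geodesic of $\bar g$. Then $\bar g$ is geodesically equivalent to $g$ if and only if $\bar S$ belongs to the linear subspace \[ \mathrm{aff}(S):=\{\,A\in\mathrm{Mat}_n(\mathbb R)\;:\;A\,\omega+\omega^{T}A=0\,\}, \] where the equation is an identity between matrices of 1-forms on $G$. -/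

import Mathlib

open Bundle VectorField
open scoped Manifold ContDiff Matrix

noncomputable section

/-- A (smooth) pseudo-Riemannian metric, of arbitrary signature, on a smooth manifold `M`: a smooth
field of symmetric nondegenerate bilinear forms on the tangent spaces. -/
structure PseudoRiemannianMetric {E : Type*} [NormedAddCommGroup E] [NormedSpace ℝ E]
    {H : Type*} [TopologicalSpace H] (I : ModelWithCorners ℝ E H)
    (M : Type*) [TopologicalSpace M] [ChartedSpace H M] [IsManifold I ∞ M] where
  inner (x : M) : TangentSpace I x →L[ℝ] TangentSpace I x →L[ℝ] ℝ
  symm (x : M) (v w : TangentSpace I x) : inner x v w = inner x w v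
  nondegenerate (x : M) (v : TangentSpace I x) : (∀ w, inner x v w = 0) → v = 0
  contMDiff : ContMDiff I (I.prod 𝓘(ℝ, E →L[ℝ] E →L[ℝ] ℝ)) ∞
    (fun x ↦ TotalSpace.mk' (E →L[ℝ] E →L[ℝ] ℝ)
      (E := fun x : M ↦ TangentSpace I x →L[ℝ] TangentSpace I x →L[ℝ] ℝ) x (inner x))

namespace PseudoRiemannianMetric

variable {E : Type*} [NormedAddCommGroup E] [NormedSpace ℝ E]
  {H : Type*} [TopologicalSpace H] {I : ModelWithCorners ℝ E H}
  {M : Type*} [TopologicalSpace M] [ChartedSpace H M] [IsManifold I ∞ M]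
  (g : PseudoRiemannianMetric I M)

theorem mdiff {X Y : Π x : M, TangentSpace I x} {x : M} (hX : MDiffAt (T% X) x)
    (hY : MDiffAt (T% Y) x) :
    MDiffAt (fun p ↦ g.inner p (X p) (Y p)) x := by
  have : MDifferentiableAt I (I.prod 𝓘(ℝ))
      (fun m ↦ TotalSpace.mk' ℝ (E := Bundle.Trivial M ℝ) m (g.inner m (X m) (Y m))) x := by
    apply MDifferentiableAt.clm_bundle_apply₂ (F₁ := E) (F₂ := E)
    · exact g.contMDiff.mdifferentiableAt (by simp)
    · exact hX
    · exact hY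
  simp only [mdifferentiableAt_totalSpace] at this
  exact this.2

/-- The right-hand side of the Koszul formula for `2 g(∇_X Y, Z)` at `x`. -/
def koszul (X Y Z : Π x : M, TangentSpace I x) (x : M) : ℝ :=
  d% (fun p ↦ g.inner p (Y p) (Z p)) x (X x) + d% (fun p ↦ g.inner p (X p) (Z p)) x (Y x)
    - d% (fun p ↦ g.inner p (X p) (Y p)) x (Z x)
    + g.inner x (mlieBracket I X Y x) (Z x) - g.inner x (mlieBracket I X Z x) (Y x)
    - g.inner x (mlieBracket I Y Z x) (X x)

theorem eq_of_inner_extend {x : M} {v w : TangentSpace I x}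
    (h : ∀ Z : Π x : M, TangentSpace I x, MDiffAt (T% Z) x →
      g.inner x v (Z x) = g.inner x w (Z x)) : v = w := by
  rw [← sub_eq_zero]
  refine g.nondegenerate x _ fun u ↦ ?_
  have := h (FiberBundle.extend E u) (FiberBundle.mdifferentiableAt_extend ..)
  rw [FiberBundle.extend_apply_self] at this
  simp [this]

/-- A covariant derivative on the tangent bundle is a Levi-Civita connection of `g` if it is
torsion free and compatible with `g`. -/
structure IsLeviCivita (cov : CovariantDerivative I E (fun x : M ↦ TangentSpace I x)) : Prop where
  torsion_free {X Y : Π x : M, TangentSpace I x} {x : M} :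
    MDiffAt (T% X) x → MDiffAt (T% Y) x →
      cov Y x (X x) - cov X x (Y x) = mlieBracket I X Y x
  metric {X Y Z : Π x : M, TangentSpace I x} {x : M} :
    MDiffAt (T% X) x → MDiffAt (T% Y) x → MDiffAt (T% Z) x →
      d% (fun p ↦ g.inner p (Y p) (Z p)) x (X x)
        = g.inner x (cov Y x (X x)) (Z x) + g.inner x (Y x) (cov Z x (X x))

variable [FiniteDimensional ℝ E]

theorem koszul_tensorial₁ {Y Z : Π x : M, TangentSpace I x} {x : M}
    (hY : MDiffAt (T% Y) x) (hZ : MDiffAt (T% Z) x) :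
    TensorialAt I E (fun X ↦ g.koszul X Y Z x) x where
  smul {f X} hf hX := by
    have := FiniteDimensional.complete ℝ E
    have e1 := mvfderiv_fun_mul hf (g.mdiff hX hZ)
    have e2 := mvfderiv_fun_mul hf (g.mdiff hX hY)
    simp only [koszul, Pi.smul_apply', map_smul, smul_apply, smul_eq_mul, e1, e2,
      mlieBracket_smul_left hf hX, add_apply, map_add, map_neg, neg_apply,
      neg_smul]
    rw [g.symm x (X x) (Y x)]
    ring
  add {X X'} hX hX' := by
    have := FiniteDimensional.complete ℝ E
    have e1 := mvfderiv_fun_add (g.mdiff hX hZ) (g.mdiff hX' hZ)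
    have e2 := mvfderiv_fun_add (g.mdiff hX hY) (g.mdiff hX' hY)
    simp only [koszul, Pi.add_apply, map_add, add_apply, e1, e2,
      mlieBracket_add_left hX hX']
    ring

theorem koszul_tensorial₃ {X Y : Π x : M, TangentSpace I x} {x : M}
    (hX : MDiffAt (T% X) x) (hY : MDiffAt (T% Y) x) :
    TensorialAt I E (fun Z ↦ g.koszul X Y Z x) x where
  smul {f Z} hf hZ := by
    have := FiniteDimensional.complete ℝ E
    have e1 := mvfderiv_fun_mul hf (g.mdiff hX hZ)
    have e2 := mvfderiv_fun_mul hf (g.mdiff hY hZ)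
    simp only [koszul, Pi.smul_apply', map_smul, smul_apply, smul_eq_mul, e1, e2,
      mlieBracket_smul_right hf hZ, add_apply, map_add]
    rw [g.symm x (Z x) (Y x), g.symm x (Z x) (X x)]
    ring
  add {Z Z'} hZ hZ' := by
    have := FiniteDimensional.complete ℝ E
    have e1 := mvfderiv_fun_add (g.mdiff hX hZ) (g.mdiff hX hZ')
    have e2 := mvfderiv_fun_add (g.mdiff hY hZ) (g.mdiff hY hZ')
    simp only [koszul, Pi.add_apply, map_add, add_apply, e1, e2,
      mlieBracket_add_right hZ hZ']
    ring

theorem koszul_add₂ {X Y Y' Z : Π x : M, TangentSpace I x} {x : M}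
    (hX : MDiffAt (T% X) x) (hY : MDiffAt (T% Y) x) (hY' : MDiffAt (T% Y') x)
    (hZ : MDiffAt (T% Z) x) :
    g.koszul X (Y + Y') Z x = g.koszul X Y Z x + g.koszul X Y' Z x := by
  have := FiniteDimensional.complete ℝ E
  have e1 := mvfderiv_fun_add (g.mdiff hX hY) (g.mdiff hX hY')
  have e2 := mvfderiv_fun_add (g.mdiff hY hZ) (g.mdiff hY' hZ)
  simp only [koszul, Pi.add_apply, map_add, add_apply, e1, e2,
    mlieBracket_add_right hY hY', mlieBracket_add_left hY hY']
  ring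

theorem koszul_smul₂ {f : M → ℝ} {X Y Z : Π x : M, TangentSpace I x} {x : M} (hf : MDiffAt f x)
    (hX : MDiffAt (T% X) x) (hY : MDiffAt (T% Y) x) (hZ : MDiffAt (T% Z) x) :
    g.koszul X (f • Y) Z x
      = f x * g.koszul X Y Z x + 2 * (d% f x (X x) * g.inner x (Y x) (Z x)) := by
  have := FiniteDimensional.complete ℝ E
  have e1 := mvfderiv_fun_mul hf (g.mdiff hX hY)
  have e2 := mvfderiv_fun_mul hf (g.mdiff hY hZ)
  simp only [koszul, Pi.smul_apply', map_smul, smul_apply, smul_eq_mul, e1, e2,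
      mlieBracket_smul_right hf hY, mlieBracket_smul_left hf hY, add_apply, map_add, map_neg,
      neg_apply, neg_smul]
  rw [g.symm x (Y x) (X x)]
  ring

theorem exists_koszul_solution {Y : Π x : M, TangentSpace I x} {x : M} (hY : MDiffAt (T% Y) x) :
    ∃ L : TangentSpace I x →L[ℝ] TangentSpace I x, ∀ X Z : Π x : M, TangentSpace I x,
      MDiffAt (T% X) x → MDiffAt (T% Z) x → 2 * g.inner x (L (X x)) (Z x) = g.koszul X Y Z x := by
  have ht2 : T2Space (TangentSpace I x) := FiberBundle.t2Space E (fun x : M ↦ TangentSpace I x) x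
  let A : TangentSpace I x →L[ℝ] TangentSpace I x →L[ℝ] ℝ :=
    TensorialAt.mkHom₂ (I := I) (F := E) (F' := E) (fun X Z ↦ g.koszul X Y Z x) x
      (fun Z hZ ↦ g.koszul_tensorial₁ hY hZ) (fun X hX ↦ g.koszul_tensorial₃ hX hY)
  have hfd : FiniteDimensional ℝ (TangentSpace I x) := inferInstanceAs (FiniteDimensional ℝ E)
  let B : TangentSpace I x →ₗ[ℝ] Module.Dual ℝ (TangentSpace I x) :=
    { toFun v := (g.inner x v).toLinearMap
      map_add' v w := by ext; simp
      map_smul' c v := by ext; simp }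
  have hB : Function.Injective B := by
    rw [injective_iff_map_eq_zero]
    intro v hv
    exact g.nondegenerate x v fun w ↦ congrArg (fun l ↦ l w) hv
  let e := LinearEquiv.ofInjectiveOfFinrankEq B hB Subspace.dual_finrank_eq.symm
  let A' : TangentSpace I x →ₗ[ℝ] Module.Dual ℝ (TangentSpace I x) :=
    { toFun v := (A v).toLinearMap
      map_add' v w := by ext; simp
      map_smul' c v := by ext; simp }
  let L : TangentSpace I x →ₗ[ℝ] TangentSpace I x := (1 / 2 : ℝ) • (e.symm.toLinearMap ∘ₗ A')
  refine ⟨LinearMap.toContinuousLinearMap L, fun X Z hX hZ ↦ ?_⟩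
  have h1 : g.inner x (e.symm (A' (X x))) (Z x) = A (X x) (Z x) :=
    congrArg (fun l ↦ l (Z x)) (e.apply_symm_apply (A' (X x)))
  have h2 : A (X x) (Z x) = g.koszul X Y Z x := TensorialAt.mkHom₂_apply _ _ hX hZ
  rw [← h2, ← h1]
  change 2 * g.inner x ((1 / 2 : ℝ) • e.symm (A' (X x))) (Z x) = _
  simp

/-- Every pseudo-Riemannian metric has a Levi-Civita connection. -/
theorem exists_isLeviCivita :
    ∃ cov : CovariantDerivative I E (fun x : M ↦ TangentSpace I x), g.IsLeviCivita cov := by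
  classical
  choose L hL using fun (Y : Π x : M, TangentSpace I x) (x : M) (hY : MDiffAt (T% Y) x) ↦
    g.exists_koszul_solution hY
  have hext {x : M} {A B : TangentSpace I x →L[ℝ] TangentSpace I x}
      (h : ∀ X Z : Π x : M, TangentSpace I x, MDiffAt (T% X) x → MDiffAt (T% Z) x →
        2 * g.inner x (A (X x)) (Z x) = 2 * g.inner x (B (X x)) (Z x)) : A = B := by
    ext u
    refine g.eq_of_inner_extend fun Z hZ ↦ ?_
    have := h (FiberBundle.extend E u) Z (FiberBundle.mdifferentiableAt_extend ..) hZ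
    rw [FiberBundle.extend_apply_self] at this
    linarith
  let cov : CovariantDerivative I E (fun x : M ↦ TangentSpace I x) :=
    { toFun Y x := if hY : MDiffAt (T% Y) x then L Y x hY else 0
      isCovariantDerivativeOnUniv :=
        { add {Y Y' x} hY hY' _ := by
            have hs : MDiffAt (T% (Y + Y')) x := mdifferentiableAt_add_section hY hY'
            simp only [dif_pos hs, dif_pos hY, dif_pos hY']
            refine hext fun X Z hX hZ ↦ ?_
            rw [hL _ _ hs X Z hX hZ, g.koszul_add₂ hX hY hY' hZ, ← hL _ _ hY X Z hX hZ,
              ← hL _ _ hY' X Z hX hZ]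
            simp [mul_add]
          leibniz {Y f x} hY hf _ := by
            have hs : MDiffAt (T% (f • Y)) x := hf.smul_section hY
            simp only [dif_pos hs, dif_pos hY]
            refine hext fun X Z hX hZ ↦ ?_
            rw [hL _ _ hs X Z hX hZ, g.koszul_smul₂ hf hX hY hZ, ← hL _ _ hY X Z hX hZ]
            simp
            ring } }
  have hcov {Y : Π x : M, TangentSpace I x} {x : M} (hY : MDiffAt (T% Y) x) :
      cov Y x = L Y x hY := dif_pos hY
  refine ⟨cov, ⟨fun {X Y x} hX hY ↦ ?_, fun {X Y Z x} hX hY hZ ↦ ?_⟩⟩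
  · refine g.eq_of_inner_extend fun Z hZ ↦ ?_
    rw [hcov hX, hcov hY]
    have h1 := hL Y x hY X Z hX hZ
    have h2 := hL X x hX Y Z hY hZ
    have h3 : (fun p ↦ g.inner p (X p) (Y p)) = fun p ↦ g.inner p (Y p) (X p) :=
      funext fun p ↦ g.symm p _ _
    have h4 : mlieBracket I Y X x = - mlieBracket I X Y x := mlieBracket_swap_apply
    simp only [koszul, h3, h4, map_neg, neg_apply] at h1 h2
    simp only [map_sub, sub_apply]
    linarith
  · rw [hcov hY, hcov hZ, g.symm x (Y x)]
    have h1 := hL Y x hY X Z hX hZ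
    have h2 := hL Z x hZ X Y hX hY
    have h3 : (fun p ↦ g.inner p (Z p) (Y p)) = fun p ↦ g.inner p (Y p) (Z p) :=
      funext fun p ↦ g.symm p _ _
    have h4 : mlieBracket I Z Y x = - mlieBracket I Y Z x := mlieBracket_swap_apply
    simp only [koszul, h3, h4, map_neg, neg_apply] at h1 h2
    linarith

/-- The Levi-Civita connection of `g`. (It is unique as an operator on differentiable vector fields;
its values on fields that are not differentiable are irrelevant.) -/
def leviCivita : CovariantDerivative I E (fun x : M ↦ TangentSpace I x) :=
  g.exists_isLeviCivita.choose

theorem isLeviCivita_leviCivita : g.IsLeviCivita g.leviCivita :=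
  g.exists_isLeviCivita.choose_spec

/-- The covariant acceleration `∇_{γ'} γ'` of a curve `γ` at time `t`, for the Levi-Civita connection
of `g`. It is computed in the chart at `γ t`, which is the chart through which Mathlib identifies
`TangentSpace I (γ t)` with `E`: if `u` is the expression of `γ` in that chart, then
`∇_{γ'} γ' = u'' + Γ(u', u')`, where `Γ(v, v) = ∇_v V` for the vector field `V` whose components in
that chart are constant (this is `FiberBundle.extend`), equal to those of `v`. -/
def covAcceleration (γ : ℝ → M) (t : ℝ) : TangentSpace I (γ t) :=
  let v : TangentSpace I (γ t) := mfderiv 𝓘(ℝ, ℝ) I γ t (1 : ℝ)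
  let u : ℝ → E := fun s ↦ extChartAt I (γ t) (γ s)
  let a : TangentSpace I (γ t) := (deriv (deriv u) t : E)
  a + g.leviCivita (FiberBundle.extend E v) (γ t) v

/-- `γ` is a (parameterized) geodesic of `g` on the open set `J` of times. -/
def IsGeodesicOn (γ : ℝ → M) (J : Set ℝ) : Prop :=
  ContMDiffOn 𝓘(ℝ, ℝ) I 2 γ J ∧ ∀ t ∈ J, g.covAcceleration γ t = 0

/-- `g'` is geodesically equivalent to `g`: every geodesic of `g`, on an open interval `J`, is a
reparameterized geodesic of `g'`, i.e. equals `γ' ∘ φ` on `J` for a regular change of parameter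
`φ` from `J` onto `φ '' J` and a geodesic `γ'` of `g'` on `φ '' J`. -/
def GeodesicallyEquivalent (g g' : PseudoRiemannianMetric I M) : Prop :=
  ∀ (γ : ℝ → M) (J : Set ℝ), IsOpen J → IsPreconnected J → g.IsGeodesicOn γ J →
    ∃ (φ : ℝ → ℝ) (γ' : ℝ → M), ContDiffOn ℝ 2 φ J ∧ (∀ t ∈ J, deriv φ t ≠ 0) ∧
      g'.IsGeodesicOn γ' (φ '' J) ∧ ∀ t ∈ J, γ t = γ' (φ t)

end PseudoRiemannianMetric

namespace PseudoRiemannianMetric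

variable {E : Type*} [NormedAddCommGroup E] [NormedSpace ℝ E]
  {H : Type*} [TopologicalSpace H] {I : ModelWithCorners ℝ E H}
  {G : Type*} [TopologicalSpace G] [ChartedSpace H G] [Group G] [LieGroup I ∞ G]
  (g : PseudoRiemannianMetric I G)

/-- The metric `g` on the Lie group `G` is left invariant: all left translations are isometries. -/
def IsLeftInvariant : Prop :=
  ∀ (a x : G) (v w : TangentSpace I x),
    g.inner (a * x) (mfderiv I I (fun y ↦ a * y) x v) (mfderiv I I (fun y ↦ a * y) x w)
      = g.inner x v w

/-- The matrix `S = (g(e_i, e_j))` of a left invariant metric in a basis of the Lie algebra. -/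
def matrix {n : ℕ} (e : Module.Basis (Fin n) ℝ (GroupLieAlgebra I G)) :
    Matrix (Fin n) (Fin n) ℝ :=
  Matrix.of fun i j ↦ g.inner 1 (e i) (e j)

variable [FiniteDimensional ℝ E]

/-- The connection matrix `ω = (ω^j_i)` of 1-forms on `G` of the Levi-Civita connection of `g` in the
left invariant frame `(e_i)`, i.e. `∇_v e_i = ∑ j, ω^j_i(v) e_j`. The coefficient of `u ∈ T_x G` at
`e_j` is the `j`-th coordinate, in the basis of the Lie algebra, of the left translate of `u` to the
identity. The row index is the upper index `j`, the column index is `i`. -/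
def connectionForm {n : ℕ} (e : Module.Basis (Fin n) ℝ (GroupLieAlgebra I G)) (x : G)
    (v : TangentSpace I x) : Matrix (Fin n) (Fin n) ℝ :=
  Matrix.of fun j i ↦
    let u : TangentSpace I x := g.leviCivita (mulInvariantVectorField (e i)) x v
    let u₁ : GroupLieAlgebra I G := mfderiv I I (fun y ↦ x⁻¹ * y) x u
    e.repr u₁ j

/-- The linear subspace `aff` of all matrices `A` with `A ω + ωᵀ A = 0`, an identity between
matrices of 1-forms on `G`. -/
def aff {n : ℕ} (e : Module.Basis (Fin n) ℝ (GroupLieAlgebra I G)) :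
    Submodule ℝ (Matrix (Fin n) (Fin n) ℝ) where
  carrier := {A | ∀ (x : G) (v : TangentSpace I x),
    A * g.connectionForm e x v + (g.connectionForm e x v)ᵀ * A = 0}
  add_mem' {A B} hA hB x v := by
    rw [add_mul, mul_add, add_add_add_comm, hA x v, hB x v, add_zero]
  zero_mem' x v := by simp
  smul_mem' c A hA x v := by
    rw [smul_mul_assoc, mul_smul_comm, ← smul_add, hA x v, smul_zero]

end PseudoRiemannianMetric

end

noncomputable section

section LinearAlgebra

variable {n : ℕ}

/-- A matrix that is skew with respect to a symmetric invertible bilinear form has trace zero. -/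
theorem Matrix.trace_eq_zero_of_skew {S A : Matrix (Fin n) (Fin n) ℝ} (hS : IsUnit S.det)
    (h : S * A + Aᵀ * S = 0) : A.trace = 0 := by
  have h1 : A = -(S⁻¹ * (Aᵀ * S)) := by
    rw [← neg_eq_of_add_eq_zero_right (a := S * A) h, mul_neg, neg_neg,
      Matrix.nonsing_inv_mul_cancel_left _ _ hS]
  have h2 : A.trace = -A.trace := by
    conv_lhs => rw [h1]
    rw [Matrix.trace_neg, Matrix.trace_mul_comm, Matrix.mul_assoc, Matrix.mul_nonsing_inv _ hS,
      mul_one, Matrix.trace_transpose]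
  linarith

/-- The algebra behind the uniqueness of the Levi-Civita connection. -/
theorem Matrix.eq_zero_of_skew_of_symm {S : Matrix (Fin n) (Fin n) ℝ} (hS : IsUnit S.det)
    (hSt : Sᵀ = S) {D : (Fin n → ℝ) → Matrix (Fin n) (Fin n) ℝ}
    (hskew : ∀ u, S * D u + (D u)ᵀ * S = 0) (hsymm : ∀ u v, D u *ᵥ v = D v *ᵥ u)
    (u : Fin n → ℝ) : D u = 0 := by
  have h1 (u v w : Fin n → ℝ) : w ⬝ᵥ S *ᵥ (D u *ᵥ v) = -(v ⬝ᵥ S *ᵥ (D u *ᵥ w)) := by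
    have := congrArg (fun A ↦ w ⬝ᵥ A *ᵥ v) (hskew u)
    simp only [Matrix.add_mulVec, dotProduct_add, Matrix.zero_mulVec, dotProduct_zero,
      ← Matrix.mulVec_mulVec] at this
    have h2 : w ⬝ᵥ (D u)ᵀ *ᵥ (S *ᵥ v) = v ⬝ᵥ S *ᵥ (D u *ᵥ w) := by
      rw [Matrix.mulVec_transpose, dotProduct_comm, ← Matrix.dotProduct_mulVec, dotProduct_comm,
        Matrix.dotProduct_mulVec, ← Matrix.mulVec_transpose, hSt, dotProduct_comm]
    linarith
  have h3 (u v w : Fin n → ℝ) : w ⬝ᵥ S *ᵥ (D u *ᵥ v) = 0 := by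
    have e1 := h1 v u w
    have e2 := h1 w v u
    have e3 := h1 u w v
    rw [hsymm v u] at e1
    rw [hsymm w v] at e2
    rw [hsymm u w] at e3
    linarith
  have h4 (v : Fin n → ℝ) : D u *ᵥ v = 0 := by
    have : S *ᵥ (D u *ᵥ v) = 0 := dotProduct_eq_zero _ fun w ↦ by rw [dotProduct_comm, h3]
    have := congrArg (S⁻¹ *ᵥ ·) this
    simpa [Matrix.mulVec_mulVec, ← Matrix.mul_assoc, Matrix.nonsing_inv_mul _ hS] using this
  exact Matrix.ext_of_mulVec_single fun i ↦ by rw [h4, Matrix.zero_mulVec]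

/-- A symmetric bilinear map `D` for which every vector `u` is an eigenvector of `D u`
(with respect to some eigenvalue), and all of whose partial maps have trace zero, vanishes. -/
theorem Matrix.eq_zero_of_trace_of_forall_eigenvector
    {D : (Fin n → ℝ) → Matrix (Fin n) (Fin n) ℝ}
    (hsymm : ∀ u v, D u *ᵥ v = D v *ᵥ u) (htr : ∀ u, (D u).trace = 0)
    (heig : ∀ u, ∃ m : ℝ, D u *ᵥ u = m • u) (u : Fin n → ℝ) : D u = 0 := by
  choose m hm using heig
  have hadd (u v w : Fin n → ℝ) : D (u + v) *ᵥ w = D u *ᵥ w + D v *ᵥ w := by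
    rw [hsymm, Matrix.mulVec_add, hsymm w, hsymm w]
  have hneg (u w : Fin n → ℝ) : D (-u) *ᵥ w = -(D u *ᵥ w) := by
    rw [hsymm, Matrix.mulVec_neg, hsymm w]
  have hind (u v : Fin n → ℝ) (h : LinearIndependent ℝ ![u, v]) :
      (2 : ℝ) • D u *ᵥ v = m u • v + m v • u := by
    have e1 := hm (u + v)
    have e2 := hm (u + -v)
    have e3 := hm u
    have e4 := hm v
    rw [hadd, Matrix.mulVec_add, Matrix.mulVec_add, hsymm v u, e3, e4] at e1
    rw [hadd, Matrix.mulVec_add, Matrix.mulVec_add, hneg, hneg, Matrix.mulVec_neg,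
      Matrix.mulVec_neg, hsymm v u, e3, e4] at e2
    have e5 : (2 * m u - m (u + v) - m (u + -v)) • u + (2 * m v - m (u + v) + m (u + -v)) • v
        = 0 := by
      linear_combination (norm := module) e1 + e2
    obtain ⟨e6, e7⟩ := LinearIndependent.pair_iff.1 h _ _ e5
    have e8 : m (u + v) = m u + m v := by linarith
    rw [e8] at e1
    linear_combination (norm := module) e1
  have hmz (u : Fin n → ℝ) : D u *ᵥ u = 0 := by
    by_cases hu : u = 0
    · simp [hu]
    obtain ⟨i, hi⟩ := Function.ne_iff.1 hu
    obtain ⟨l, hl⟩ : ∃ l : (Fin n → ℝ) →ₗ[ℝ] ℝ, l u = 1 :=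
      ⟨(u i)⁻¹ • LinearMap.proj i, by simpa using inv_mul_cancel₀ hi⟩
    let T : (Fin n → ℝ) →ₗ[ℝ] (Fin n → ℝ) := (2 : ℝ) • (D u).mulVecLin - m u • LinearMap.id
    have hT (v : Fin n → ℝ) : ∃ a : ℝ, T v = a • u := by
      by_cases h : LinearIndependent ℝ ![u, v]
      · refine ⟨m v, ?_⟩
        have := hind u v h
        simp only [T, LinearMap.sub_apply, LinearMap.smul_apply, Matrix.mulVecLin_apply, this,
          LinearMap.id_apply]
        abel
      · rw [LinearIndependent.pair_iff' hu] at h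
        push Not at h
        obtain ⟨a, rfl⟩ := h
        refine ⟨a * m u, ?_⟩
        simp only [T, LinearMap.sub_apply, LinearMap.smul_apply, Matrix.mulVecLin_apply,
          LinearMap.id_apply, Matrix.mulVec_smul, hm]
        module
    have hT' : T = (l ∘ₗ T).smulRight u := by
      refine LinearMap.ext fun v ↦ ?_
      obtain ⟨a, ha⟩ := hT v
      simp [ha, hl]
    have htT : LinearMap.trace ℝ _ T = m u := by
      rw [hT', LinearMap.trace_smulRight]
      simp only [T, LinearMap.comp_apply, LinearMap.sub_apply, LinearMap.smul_apply,
        Matrix.mulVecLin_apply, LinearMap.id_apply, hm, map_sub, map_smul, hl]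
      simp; ring
    have htT' : LinearMap.trace ℝ _ T = -(m u * n) := by
      have : LinearMap.trace ℝ _ (D u).mulVecLin = 0 := by
        rw [← Matrix.toLin'_apply', Matrix.trace_toLin'_eq, htr]
      simp only [T, map_sub, map_smul, this]
      simp
    have h0 : m u * (n + 1) = 0 := by linarith
    have h1 : m u = 0 := (mul_eq_zero.1 h0).resolve_right (by positivity)
    rw [hm, h1, zero_smul]
  have h4 (v : Fin n → ℝ) : D u *ᵥ v = 0 := by
    have e := hmz (u + v)
    rw [hadd, Matrix.mulVec_add, Matrix.mulVec_add, hsymm v u, hmz, hmz, zero_add, add_zero,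
      ← two_smul ℝ] at e
    exact (smul_eq_zero.1 e).resolve_left two_ne_zero
  exact Matrix.ext_of_mulVec_single fun i ↦ by rw [h4, Matrix.zero_mulVec]

end LinearAlgebra

section Manifold

variable {E : Type*} [NormedAddCommGroup E] [NormedSpace ℝ E]
  {H : Type*} [TopologicalSpace H] {I : ModelWithCorners ℝ E H}
  {M : Type*} [TopologicalSpace M] [ChartedSpace H M] [IsManifold I ∞ M]

/-- The components of a vector field in the chart at `x`. -/
def fieldInChart (I : ModelWithCorners ℝ E H) {M : Type*} [TopologicalSpace M] [ChartedSpace H M]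
    [IsManifold I ∞ M] (x : M) (Y : Π p : M, TangentSpace I p) (p : M) : E :=
  tangentCoordChange I p x p (Y p)

theorem mdifferentiableAt_fieldInChart {x : M} {Y : Π p : M, TangentSpace I p}
    (hY : MDiffAt (T% Y) x) : MDiffAt (fieldInChart I x Y) x :=
  (mdifferentiableAt_section (F := E) (E := fun p : M ↦ TangentSpace I p) I Y).1 hY

theorem fieldInChart_self (x : M) (Y : Π p : M, TangentSpace I p) :
    fieldInChart I x Y x = Y x :=
  tangentCoordChange_self (mem_extChartAt_source x)

theorem fieldInChart_add (x : M) (Y Z : Π p : M, TangentSpace I p) :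
    fieldInChart I x (Y + Z) = fieldInChart I x Y + fieldInChart I x Z :=
  funext fun p ↦ map_add (tangentCoordChange I p x p) (Y p) (Z p)

theorem fieldInChart_smul (x : M) (f : M → ℝ) (Y : Π p : M, TangentSpace I p) :
    fieldInChart I x (f • Y) = f • fieldInChart I x Y :=
  funext fun p ↦ map_smul (tangentCoordChange I p x p) (f p) (Y p)

theorem fieldInChart_extend_eventuallyEq (x : M) (v : TangentSpace I x) :
    fieldInChart I x (FiberBundle.extend E v) =ᶠ[nhds x] fun _ ↦ (v : E) := by
  filter_upwards [(trivializationAt E (TangentSpace I) x).open_baseSet.mem_nhds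
    (FiberBundle.mem_baseSet_trivializationAt' x)] with p hp
  have h := (trivializationAt E (TangentSpace I) x).apply_mk_symm hp
    (trivializationAt E (TangentSpace I) x ⟨x, v⟩).2
  have h2 : fieldInChart I x (FiberBundle.extend E v) p
      = (trivializationAt E (TangentSpace I) x ⟨x, v⟩).2 := congrArg Prod.snd h
  rw [h2]
  exact tangentCoordChange_self (I := I) (mem_extChartAt_source x)

variable [FiniteDimensional ℝ E]

/-- The components of the covariant derivative `∇_w Y` at `x` in the chart at `x`. -/
def CovariantDerivative.inChart (cov : CovariantDerivative I E (fun x : M ↦ TangentSpace I x))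
    (Y : Π p : M, TangentSpace I p) (x : M) (w : TangentSpace I x) : E :=
  cov Y x w

/-- In the chart at `x`, a covariant derivative is the sum of the derivative of the components and
of a term of order zero. -/
theorem CovariantDerivative.inChart_eq_mvfderiv_add
    (cov : CovariantDerivative I E (fun x : M ↦ TangentSpace I x)) {x : M}
    {Y : Π p : M, TangentSpace I p} (hY : MDiffAt (T% Y) x) (w : TangentSpace I x) :
    cov.inChart Y x w
      = d% (fieldInChart I x Y) x w + cov.inChart (FiberBundle.extend E (Y x)) x w := by
  have ht : TensorialAt I E (V := fun x : M ↦ TangentSpace I x)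
      (fun Z ↦ cov.inChart Z x w - d% (fieldInChart I x Z) x w) x := by
    refine ⟨fun {f Z} hf hZ ↦ ?_, fun {Z Z'} hZ hZ' ↦ ?_⟩
    · have h1 : cov.inChart (f • Z) x w
          = f x • cov.inChart Z x w + d% f x w • fieldInChart I x Z x := by
        rw [fieldInChart_self]
        exact congrArg (fun L ↦ L w) (cov.isCovariantDerivativeOnUniv.leibniz hZ hf)
      have h2 : d% (fieldInChart I x (f • Z)) x w
          = f x • d% (fieldInChart I x Z) x w + d% f x w • fieldInChart I x Z x := by
        rw [fieldInChart_smul, mvfderiv_smul hf (mdifferentiableAt_fieldInChart hZ)]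
        rfl
      rw [h1, h2]
      module
    · have h1 : cov.inChart (Z + Z') x w = cov.inChart Z x w + cov.inChart Z' x w :=
        congrArg (fun L ↦ L w) (cov.isCovariantDerivativeOnUniv.add hZ hZ')
      have h2 : d% (fieldInChart I x (Z + Z')) x w
          = d% (fieldInChart I x Z) x w + d% (fieldInChart I x Z') x w := by
        rw [fieldInChart_add, mvfderiv_add (mdifferentiableAt_fieldInChart hZ)
          (mdifferentiableAt_fieldInChart hZ')]
        rfl
      rw [h1, h2]
      abel
  have h := ht.pointwise hY (FiberBundle.mdifferentiableAt_extend I E (Y x))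
    (FiberBundle.extend_apply_self E (Y x)).symm
  have h0 : d% (fieldInChart I x (FiberBundle.extend E (Y x))) x = 0 :=
    (Filter.EventuallyEq.mfderiv_eq (I' := 𝓘(ℝ, E))
      (fieldInChart_extend_eventuallyEq x (Y x))).trans mfderiv_const
  rw [h0, zero_apply, sub_zero] at h
  exact sub_eq_iff_eq_add'.1 h

end Manifold

section LieGroup

variable {E : Type*} [NormedAddCommGroup E] [NormedSpace ℝ E]
  {H : Type*} [TopologicalSpace H] {I : ModelWithCorners ℝ E H}
  {G : Type*} [TopologicalSpace G] [ChartedSpace H G] [Group G]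
  {n : ℕ} (e : Module.Basis (Fin n) ℝ (GroupLieAlgebra I G))

variable (I G) in
theorem LieGroup.of_infty_minSmoothness [LieGroup I ∞ G] : LieGroup I (minSmoothness ℝ 3) G := by
  rw [minSmoothness_of_isRCLikeNormedField]
  exact LieGroup.of_le (n := ∞) (ENat.LEInfty.out)

/-- The left invariant vector field with constant components `c` in the frame `e`. -/
def frameField (c : Fin n → ℝ) (x : G) : TangentSpace I x :=
  mulInvariantVectorField (e.equivFun.symm c) x

theorem frameField_add (c d : Fin n → ℝ) :
    frameField e (c + d) = frameField e c + frameField e d := by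
  unfold frameField
  rw [map_add]
  exact mulInvariantVectorField_add _ _

theorem frameField_smul (a : ℝ) (c : Fin n → ℝ) :
    frameField e (a • c) = a • frameField e c := by
  unfold frameField
  rw [map_smul]
  exact mulInvariantVectorField_smul _ _

theorem frameField_repr (v : GroupLieAlgebra I G) :
    frameField e (e.equivFun v) = mulInvariantVectorField v := by
  unfold frameField
  rw [LinearEquiv.symm_apply_apply]

theorem frameField_single (i : Fin n) :
    frameField e (Pi.single i 1) = mulInvariantVectorField (e i) := by
  unfold frameField
  simp

/-- The value at `x` of the vector fields with constant components in the frame `e`, as a linear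
map. -/
def frameAt (x : G) : (Fin n → ℝ) →ₗ[ℝ] TangentSpace I x where
  toFun c := frameField e c x
  map_add' c d := congrFun (frameField_add e c d) x
  map_smul' a c := congrFun (frameField_smul e a c) x

variable [LieGroup I ∞ G]

theorem mdifferentiableAt_frameField (c : Fin n → ℝ) (x : G) :
    MDiffAt (T% (frameField e c)) x := by
  have := LieGroup.of_infty_minSmoothness I G
  exact mdifferentiableAt_mulInvariantVectorField _

theorem contMDiff_frameField (c : Fin n → ℝ) :
    ContMDiff I I.tangent 2 (T% (frameField e c)) := by
  have := LieGroup.of_infty_minSmoothness I G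
  have h := contMDiff_mulInvariantVectorField (I := I) (G := G) (e.equivFun.symm c)
  exact h.of_le le_minSmoothness

/-- The differential of the left translation by `x⁻¹`, from `T_x G` to the Lie algebra. -/
def leftTranslateToOne (x : G) : TangentSpace I x →L[ℝ] GroupLieAlgebra I G :=
  mfderiv I I (fun y ↦ x⁻¹ * y) x

theorem leftTranslateToOne_mulInvariantVectorField (x : G) (v : GroupLieAlgebra I G) :
    leftTranslateToOne x (mulInvariantVectorField v x) = v := by
  have hx : MDifferentiableAt I I (fun y ↦ x * y) (1 : G) :=
    (contMDiff_mul_left (I := I) (n := ∞)).mdifferentiableAt (by simp)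
  have hx' : MDifferentiableAt I I (fun y ↦ x⁻¹ * y) (x * 1) :=
    (contMDiff_mul_left (I := I) (n := ∞)).mdifferentiableAt (by simp)
  have h := mfderiv_comp_apply (I'' := I) (1 : G) hx' hx v
  have h2 : (fun y ↦ x⁻¹ * y) ∘ (fun y ↦ x * y) = (id : G → G) := by ext; simp
  rw [h2, mfderiv_id] at h
  refine Eq.trans ?_ h.symm
  exact congrArg (fun p ↦ (mfderiv I I (fun y ↦ x⁻¹ * y) p : E →L[ℝ] E)
    (mulInvariantVectorField v x : E)) (mul_one x).symm

theorem mulInvariantVectorField_leftTranslateToOne (x : G) (u : TangentSpace I x) :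
    mulInvariantVectorField (leftTranslateToOne x u) x = u := by
  have hx : MDifferentiableAt I I (fun y ↦ x⁻¹ * y) x :=
    (contMDiff_mul_left (I := I) (n := ∞)).mdifferentiableAt (by simp)
  have hx' : MDifferentiableAt I I (fun y ↦ x * y) (x⁻¹ * x) :=
    (contMDiff_mul_left (I := I) (n := ∞)).mdifferentiableAt (by simp)
  have h := mfderiv_comp_apply (I'' := I) x hx' hx u
  have h2 : (fun y ↦ x * y) ∘ (fun y ↦ x⁻¹ * y) = (id : G → G) := by ext; simp
  rw [h2, mfderiv_id] at h
  refine Eq.trans ?_ h.symm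
  exact congrArg (fun p ↦ (mfderiv I I (fun y ↦ x * y) p : E →L[ℝ] E)
    (leftTranslateToOne x u : E)) (inv_mul_cancel x).symm

theorem leftTranslateToOne_frameField (x : G) (c : Fin n → ℝ) :
    leftTranslateToOne x (frameField e c x) = e.equivFun.symm c :=
  leftTranslateToOne_mulInvariantVectorField x _

theorem frameField_leftTranslateToOne (x : G) (u : TangentSpace I x) :
    frameField e (e.equivFun (leftTranslateToOne x u)) x = u := by
  rw [frameField_repr, mulInvariantVectorField_leftTranslateToOne]

theorem frameField_injective (x : G) {c d : Fin n → ℝ}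
    (h : frameField e c x = frameField e d x) : c = d := by
  have := congrArg (leftTranslateToOne x) h
  rwa [leftTranslateToOne_frameField, leftTranslateToOne_frameField,
    EmbeddingLike.apply_eq_iff_eq] at this

theorem mlieBracket_frameField [FiniteDimensional ℝ E] (c d : Fin n → ℝ) (x : G) :
    mlieBracket I (frameField e c) (frameField e d) x
      = frameField e (e.equivFun (mlieBracket I (frameField e c) (frameField e d) 1)) x := by
  have := LieGroup.of_infty_minSmoothness I G
  have := FiniteDimensional.complete ℝ E
  rw [frameField_repr]
  exact (congrFun (mulInvariantVector_mlieBracket (I := I) (G := G) (e.equivFun.symm c)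
    (e.equivFun.symm d)) x).symm

namespace PseudoRiemannianMetric

variable {e} {g : PseudoRiemannianMetric I G}

theorem inner_frameField (hg : g.IsLeftInvariant) (x : G) (c d : Fin n → ℝ) :
    g.inner x (frameField e c x) (frameField e d x) = c ⬝ᵥ g.matrix e *ᵥ d := by
  have h1 : g.inner x (frameField e c x) (frameField e d x)
      = g.inner 1 (e.equivFun.symm c) (e.equivFun.symm d) := by
    rw [← hg x 1]
    exact congrArg (fun p ↦ (g.inner p : E →L[ℝ] E →L[ℝ] ℝ) (frameField e c x : E)
      (frameField e d x : E)) (mul_one x).symm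
  rw [h1, Module.Basis.equivFun_symm_apply, Module.Basis.equivFun_symm_apply]
  simp only [map_sum, map_smul, sum_apply, smul_apply, smul_eq_mul, dotProduct, Matrix.mulVec,
    matrix, Matrix.of_apply, Finset.mul_sum]
  rw [Finset.sum_comm]
  refine Finset.sum_congr rfl fun i _ ↦ Finset.sum_congr rfl fun j _ ↦ ?_
  ring

theorem matrix_transpose : (g.matrix e)ᵀ = g.matrix e := by
  ext i j
  exact g.symm 1 _ _

theorem isUnit_det_matrix : IsUnit (g.matrix e).det := by
  rw [isUnit_iff_ne_zero]
  intro h0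
  obtain ⟨d, hd, h⟩ := Matrix.exists_mulVec_eq_zero_iff.2 h0
  refine hd (e.equivFun.symm.injective ?_)
  rw [map_zero]
  refine g.nondegenerate 1 _ fun w ↦ ?_
  rw [g.symm]
  let L : GroupLieAlgebra I G →ₗ[ℝ] ℝ :=
    { toFun w := g.inner 1 w (e.equivFun.symm d)
      map_add' v w := by rw [map_add, add_apply]
      map_smul' a v := by rw [map_smul, smul_apply, RingHom.id_apply] }
  have hL : L = 0 := by
    refine e.ext fun i ↦ ?_
    change g.inner 1 (e i) (e.equivFun.symm d) = 0
    have := congrFun h i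
    simp only [Matrix.mulVec, dotProduct, matrix, Matrix.of_apply, Pi.zero_apply] at this
    simp only [Module.Basis.equivFun_symm_apply, map_sum, map_smul, smul_eq_mul]
    rw [← this]
    exact Finset.sum_congr rfl fun j _ ↦ mul_comm _ _
  exact congrArg (fun L ↦ L w) hL

variable [FiniteDimensional ℝ E]

theorem leviCivita_frameField (c d : Fin n → ℝ) (x : G) :
    g.leviCivita (frameField e d) x (frameField e c x)
      = frameField e (g.connectionForm e x (frameField e c x) *ᵥ d) x := by
  have h1 (v : TangentSpace I x) (i : Fin n) :
      g.leviCivita (frameField e (Pi.single i 1)) x v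
        = frameField e (g.connectionForm e x v *ᵥ Pi.single i 1) x := by
    have h : g.connectionForm e x v *ᵥ Pi.single i 1 = e.equivFun
        (leftTranslateToOne x (g.leviCivita (frameField e (Pi.single i 1)) x v)) := by
      rw [Matrix.mulVec_single_one, frameField_single]
      rfl
    rw [h, frameField_leftTranslateToOne]
  set v := frameField e c x
  let L : (Fin n → ℝ) →ₗ[ℝ] TangentSpace I x :=
    { toFun d := g.leviCivita (frameField e d) x v
      map_add' d d' := by
        rw [frameField_add, g.leviCivita.isCovariantDerivativeOnUniv.add
          (mdifferentiableAt_frameField e d x) (mdifferentiableAt_frameField e d' x)]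
        rfl
      map_smul' a d := by
        rw [frameField_smul, g.leviCivita.isCovariantDerivativeOnUniv.smul_const a
          (mdifferentiableAt_frameField e d x)]
        rfl }
  have hL : L = frameAt e x ∘ₗ (g.connectionForm e x v).mulVecLin := by
    refine LinearMap.pi_ext' fun i ↦ LinearMap.ext_ring ?_
    exact h1 v i
  exact congrArg (fun L ↦ L d) hL

/-- The connection form is skew with respect to the metric. -/
theorem matrix_mul_connectionForm_add (hg : g.IsLeftInvariant) (x : G) (v : TangentSpace I x) :
    g.matrix e * g.connectionForm e x v + (g.connectionForm e x v)ᵀ * g.matrix e = 0 := by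
  rw [← frameField_leftTranslateToOne e x v]
  set c := e.equivFun (leftTranslateToOne x v)
  have h (d f : Fin n → ℝ) := g.isLeviCivita_leviCivita.metric (mdifferentiableAt_frameField e c x)
    (mdifferentiableAt_frameField e d x) (mdifferentiableAt_frameField e f x)
  simp only [leviCivita_frameField, inner_frameField hg, mvfderiv_const] at h
  refine Matrix.ext_of_mulVec_single fun j ↦ ?_
  rw [Matrix.zero_mulVec]
  refine dotProduct_eq_zero _ fun f ↦ ?_
  have h1 : (0 : ℝ) = (g.connectionForm e x (frameField e c x) *ᵥ f) ⬝ᵥ g.matrix e *ᵥ Pi.single j 1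
      + f ⬝ᵥ g.matrix e *ᵥ (g.connectionForm e x (frameField e c x) *ᵥ Pi.single j 1) :=
    h f (Pi.single j 1)
  rw [Matrix.add_mulVec, ← Matrix.mulVec_mulVec, ← Matrix.mulVec_mulVec, dotProduct_comm,
    dotProduct_add, h1, add_comm, Matrix.dotProduct_mulVec f (Matrix.transpose _),
    Matrix.vecMul_transpose]

theorem connectionForm_mulVec_sub (x : G) (c d : Fin n → ℝ) :
    g.connectionForm e x (frameField e c x) *ᵥ d - g.connectionForm e x (frameField e d x) *ᵥ c
      = e.equivFun (mlieBracket I (frameField e c) (frameField e d) 1) := by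
  have h := g.isLeviCivita_leviCivita.torsion_free (mdifferentiableAt_frameField e c x)
    (mdifferentiableAt_frameField e d x)
  rw [leviCivita_frameField, leviCivita_frameField, mlieBracket_frameField] at h
  refine frameField_injective e x ?_
  rw [← h]
  exact map_sub (frameAt e x) _ _

end PseudoRiemannianMetric

end LieGroup

section Curves

variable {E : Type*} [NormedAddCommGroup E] [NormedSpace ℝ E]
  {H : Type*} [TopologicalSpace H] {I : ModelWithCorners ℝ E H}
  {M : Type*} [TopologicalSpace M] [ChartedSpace H M]

theorem contDiffAt_extChartAt_comp {γ : ℝ → M} {s : ℝ} {k : ℕ∞ω}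
    (h : ContMDiffAt 𝓘(ℝ, ℝ) I k γ s) : ContDiffAt ℝ k (extChartAt I (γ s) ∘ γ) s := by
  have h1 := (contMDiffAt_iff.1 h).2
  simp only [extChartAt_model_space_eq_id, PartialEquiv.refl_symm, PartialEquiv.refl_coe,
    Function.comp_id, modelWithCornersSelf_coe, Set.range_id, contDiffWithinAt_univ, id] at h1
  exact h1

variable [IsManifold I ∞ M]

theorem HasMFDerivAt.hasDerivAt_extChartAt_comp {γ : ℝ → M} {s : ℝ} {x : M}
    {L : ℝ →L[ℝ] TangentSpace I (γ s)} (h : HasMFDerivAt 𝓘(ℝ, ℝ) I γ s L)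
    (hs : γ s ∈ (extChartAt I x).source) :
    HasDerivAt (extChartAt I x ∘ γ) (tangentCoordChange I (γ s) x (γ s) (L 1)) s := by
  rw [extChartAt_source] at hs
  have h1 := (HasMFDerivAt.comp s (hasMFDerivAt_extChartAt (I := I) hs) h).hasFDerivAt
  rw [mfderiv_chartAt_eq_tangentCoordChange hs] at h1
  have h2 : HasFDerivAt (extChartAt I x ∘ γ)
    ((tangentCoordChange I (γ s) x (γ s) : E →L[ℝ] E) ∘L (show ℝ →L[ℝ] E from L)) s := h1
  exact h2.hasDerivAt

theorem HasMFDerivAt.hasDerivAt_extChartAt_comp_self {γ : ℝ → M} {s : ℝ}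
    {L : ℝ →L[ℝ] TangentSpace I (γ s)} (h : HasMFDerivAt 𝓘(ℝ, ℝ) I γ s L) :
    HasDerivAt (extChartAt I (γ s) ∘ γ) (L 1) s :=
  (h.hasDerivAt_extChartAt_comp (mem_extChartAt_source (γ s))).congr_deriv
    (tangentCoordChange_self (mem_extChartAt_source (γ s)))

theorem HasDerivAt.hasMFDerivAt_extChartAt_symm_comp [I.Boundaryless] {y : ℝ → E} {s : ℝ} {x : M}
    {L : ℝ →L[ℝ] TangentSpace I ((extChartAt I x).symm (y s))} (hy : y s ∈ (extChartAt I x).target)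
    (h : HasDerivAt y (tangentCoordChange I ((extChartAt I x).symm (y s)) x
      ((extChartAt I x).symm (y s)) (L 1)) s) :
    HasMFDerivAt 𝓘(ℝ, ℝ) I ((extChartAt I x).symm ∘ y) s L := by
  have hp1 : (extChartAt I x).symm (y s) ∈ (extChartAt I x).source := (extChartAt I x).map_target hy
  have hp2 := mem_extChartAt_source (I := I) ((extChartAt I x).symm (y s))
  have h1 := hasFDerivWithinAt_tangentCoordChange (I := I) ⟨hp1, hp2⟩
  rw [I.range_eq_univ, hasFDerivWithinAt_univ, (extChartAt I x).right_inv hy] at h1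
  have h2 := (h1.comp_hasDerivAt s h).congr_deriv
    ((tangentCoordChange_comp ⟨⟨hp2, hp1⟩, hp2⟩).trans (tangentCoordChange_self hp2))
  have h3 := h2.hasFDerivAt.congr_fderiv (g' := (show ℝ →L[ℝ] E from L))
    (ContinuousLinearMap.ext_ring (one_smul ℝ _))
  refine ⟨(continuousAt_extChartAt_symm'' hy).comp h.continuousAt, ?_⟩
  exact h3.hasFDerivWithinAt

/-- The second derivative of a composition. -/
theorem deriv_deriv_comp {u : ℝ → E} {φ : ℝ → ℝ} {t : ℝ} (hu : ContDiffAt ℝ 2 u (φ t))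
    (hφ : ContDiffAt ℝ 2 φ t) :
    deriv (deriv (u ∘ φ)) t
      = deriv φ t ^ 2 • deriv (deriv u) (φ t) + deriv (deriv φ) t • deriv u (φ t) := by
  have h1 : deriv (u ∘ φ) =ᶠ[nhds t] fun s ↦ deriv φ s • deriv u (φ s) := by
    filter_upwards [hφ.eventually (by simp), hφ.continuousAt.eventually (hu.eventually (by simp))]
      with s hs hs'
    exact deriv.scomp s (hs'.differentiableAt (by simp)) (hs.differentiableAt (by simp))
  have h2 : DifferentiableAt ℝ (deriv φ) t :=
    (hφ.derivWithin (m := 1) (by norm_num)).differentiableAt (by simp)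
  have h3 : DifferentiableAt ℝ (deriv u) (φ t) :=
    (hu.derivWithin (m := 1) (by norm_num)).differentiableAt (by simp)
  have h4 : DifferentiableAt ℝ φ t := hφ.differentiableAt (by simp)
  rw [h1.deriv_eq]
  have h5 := h3.hasDerivAt.scomp t h4.hasDerivAt
  have h6 := h2.hasDerivAt.smul h5
  refine h6.deriv.trans ?_
  rw [pow_two, mul_smul]
  rfl

variable [FiniteDimensional ℝ E]

namespace PseudoRiemannianMetric

variable (g : PseudoRiemannianMetric I M)

/-- The Christoffel quadratic form `Γ(v, v)` at `x` in the chart at `x`. -/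
def christoffel (x : M) (v : E) : E :=
  g.leviCivita.inChart (FiberBundle.extend E (E := fun x : M ↦ TangentSpace I x) (x := x) v) x v

theorem christoffel_smul (x : M) (a : ℝ) (v : E) :
    g.christoffel x (a • v) = a ^ 2 • g.christoffel x v := by
  have hv := FiberBundle.mdifferentiableAt_extend I E (V := fun x : M ↦ TangentSpace I x) (x := x) v
  have h1 : ∀ᶠ p in nhds x,
      FiberBundle.extend E (E := fun x : M ↦ TangentSpace I x) (x := x) (a • v : E) p
        = (a • FiberBundle.extend E (E := fun x : M ↦ TangentSpace I x) (x := x) v) p := by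
    have hx := FiberBundle.mem_baseSet_trivializationAt' (F := E)
      (E := fun x : M ↦ TangentSpace I x) x
    have h2 := ((trivializationAt E (fun x : M ↦ TangentSpace I x) x).linear ℝ hx).map_smul a v
    filter_upwards [(trivializationAt E (fun x : M ↦ TangentSpace I x) x).open_baseSet.mem_nhds hx]
      with p hp
    unfold FiberBundle.extend
    rw [Pi.smul_apply]
    erw [h2]
    rw [← Trivialization.coe_symmₗ (R := ℝ) (hb := hp), map_smul]
  have h2 := (g.leviCivita.isCovariantDerivativeOnUniv.congr_of_eventuallyEq
    (FiberBundle.mdifferentiableAt_extend I E (V := fun x : M ↦ TangentSpace I x) (x := x) _)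
    (MDifferentiableAt.smul_section (f := fun _ ↦ a) mdifferentiableAt_const hv) Filter.univ_mem
    h1).trans (g.leviCivita.isCovariantDerivativeOnUniv.smul_const a hv)
  let L : E →L[ℝ] E :=
    g.leviCivita (FiberBundle.extend E (E := fun x : M ↦ TangentSpace I x) (x := x) v) x
  have h3 : (a • L) (a • v) = a ^ 2 • L v := by
    rw [smul_apply, map_smul, pow_two, mul_smul]
  exact (congrArg (fun A : E →L[ℝ] E ↦ A (a • v)) h2).trans h3

/-- The covariant acceleration in terms of the coordinate expression of the curve. -/
theorem covAcceleration_eq {γ : ℝ → M} {t : ℝ} (h : MDifferentiableAt 𝓘(ℝ, ℝ) I γ t) :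
    g.covAcceleration γ t = deriv (deriv (extChartAt I (γ t) ∘ γ)) t
      + g.christoffel (γ t) (deriv (extChartAt I (γ t) ∘ γ) t) := by
  have h1 := h.hasMFDerivAt.hasDerivAt_extChartAt_comp_self
  rw [h1.deriv]
  rfl

/-- A reparametrization changes a geodesic into a curve with tangential acceleration. -/
theorem covAcceleration_comp {γ γ' : ℝ → M} {φ : ℝ → ℝ} {t : ℝ} (hφ : ContDiffAt ℝ 2 φ t)
    (hφ' : deriv φ t ≠ 0) (hγ' : ContMDiffAt 𝓘(ℝ, ℝ) I 2 γ' (φ t))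
    (hγ : γ =ᶠ[nhds t] γ' ∘ φ) (h : g.covAcceleration γ' (φ t) = 0) :
    ∃ m : ℝ, g.covAcceleration γ t = m • mfderiv 𝓘(ℝ, ℝ) I γ t (1 : ℝ) := by
  have hγt : γ t = γ' (φ t) := hγ.eq_of_nhds
  have hu := contDiffAt_extChartAt_comp hγ'
  have hd : MDifferentiableAt 𝓘(ℝ, ℝ) I γ t := by
    refine MDifferentiableAt.congr_of_eventuallyEq ?_ hγ
    exact (hγ'.mdifferentiableAt (by simp)).comp t
      ((hφ.differentiableAt (by simp)).mdifferentiableAt)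
  have hv := hd.hasMFDerivAt.hasDerivAt_extChartAt_comp_self
  have hu' : extChartAt I (γ t) ∘ γ =ᶠ[nhds t] (extChartAt I (γ' (φ t)) ∘ γ') ∘ φ := by
    rw [hγt]
    exact hγ.fun_comp _
  rw [g.covAcceleration_eq (hγ'.mdifferentiableAt (by simp))] at h
  refine ⟨deriv (deriv φ) t / deriv φ t, ?_⟩
  rw [g.covAcceleration_eq hd, hu'.deriv.deriv_eq, hu'.deriv_eq, deriv_deriv_comp hu hφ,
    deriv.scomp t (hu.differentiableAt (by simp)) (hφ.differentiableAt (by simp)),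
    christoffel_smul, hγt]
  have hv' := hv.deriv
  rw [hu'.deriv_eq, 
    deriv.scomp t (hu.differentiableAt (by simp)) (hφ.differentiableAt (by simp))] at hv'
  set u := extChartAt I (γ' (φ t)) ∘ γ'
  have h2 : deriv φ t ^ 2 • deriv (deriv u) (φ t) + deriv (deriv φ) t • deriv u (φ t)
      + deriv φ t ^ 2 • g.christoffel (γ' (φ t)) (deriv u (φ t))
      = (deriv (deriv φ) t / deriv φ t) • (deriv φ t • deriv u (φ t)) := by
    have h' : deriv (deriv u) (φ t) + g.christoffel (γ' (φ t)) (deriv u (φ t)) = 0 := h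
    rw [smul_smul, div_mul_cancel₀ _ hφ', add_right_comm, ← smul_add, h', smul_zero, zero_add]
  exact h2.trans (congrArg (fun z : E ↦ (deriv (deriv φ) t / deriv φ t) • z) hv')

end PseudoRiemannianMetric

end Curves

section Geodesics

variable {E : Type*} [NormedAddCommGroup E] [NormedSpace ℝ E]
  {H : Type*} [TopologicalSpace H] {I : ModelWithCorners ℝ E H}
  {G : Type*} [TopologicalSpace G] [ChartedSpace H G] [Group G] [LieGroup I ∞ G]
  {n : ℕ} {e : Module.Basis (Fin n) ℝ (GroupLieAlgebra I G)}

theorem LinearMap.apply_eq_sum_single {V : Type*} [AddCommGroup V] [Module ℝ V]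
    (L : (Fin n → ℝ) →ₗ[ℝ] V) (c : Fin n → ℝ) : L c = ∑ i, c i • L (Pi.single i 1) := by
  conv_lhs => rw [← (Pi.basisFun ℝ (Fin n)).sum_repr c]
  simp

variable (e) in
theorem fieldInChart_frameField_eq_sum (x : G) (c : Fin n → ℝ) :
    fieldInChart I x (frameField e c)
      = fun p ↦ ∑ i, c i • fieldInChart I x (frameField e (Pi.single i 1)) p := by
  funext p
  exact LinearMap.apply_eq_sum_single
    ((tangentCoordChange I p x p : E →ₗ[ℝ] E) ∘ₗ (frameAt e p : (Fin n → ℝ) →ₗ[ℝ] E)) c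

variable (e) in
/-- The derivative of the velocity of a curve, expressed in a chart, if the velocity has components
`c` in the left invariant frame. -/
theorem hasDerivAt_fieldInChart_frameField {γ : ℝ → G} {c : ℝ → Fin n → ℝ} {c' : Fin n → ℝ} {t : ℝ}
    (hγ : HasMFDerivAt 𝓘(ℝ, ℝ) I γ t
      (ContinuousLinearMap.toSpanSingleton ℝ (frameField e (c t) (γ t))))
    (hc : HasDerivAt c c' t) :
    HasDerivAt (fun s ↦ fieldInChart I (γ t) (frameField e (c s)) (γ s))
      (fieldInChart I (γ t) (frameField e c') (γ t)
        + d% (fieldInChart I (γ t) (frameField e (c t))) (γ t) (frameField e (c t) (γ t))) t := by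
  set x := γ t with hx
  let F (i : Fin n) : G → E := fieldInChart I x (frameField e (Pi.single i 1))
  have hF (i : Fin n) : MDifferentiableAt I 𝓘(ℝ, E) (F i) x :=
    mdifferentiableAt_fieldInChart (mdifferentiableAt_frameField e _ x)
  have h1 (i : Fin n) : HasDerivAt (fun s ↦ F i (γ s))
      (d% (F i) x (frameField e (c t) x)) t := by
    have h := (HasMFDerivAt.comp t (hF i).hasMFDerivAt hγ).hasFDerivAt
    have h' : HasFDerivAt (fun s ↦ F i (γ s)) ((show E →L[ℝ] E from d% (F i) x) ∘L
      (ContinuousLinearMap.toSpanSingleton ℝ (frameField e (c t) x : E) : ℝ →L[ℝ] E)) t := h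
    refine h'.hasDerivAt.congr_deriv ?_
    exact congrArg (show E →L[ℝ] E from d% (F i) x) (one_smul ℝ (frameField e (c t) x : E))
  have h2 := HasDerivAt.fun_sum fun i (_ : i ∈ Finset.univ) ↦
    ((hasDerivAt_pi.1 hc) i).smul (h1 i)
  have h3 : (fun s ↦ fieldInChart I x (frameField e (c s)) (γ s))
      = fun s ↦ ∑ i, c s i • F i (γ s) := by
    funext s
    rw [fieldInChart_frameField_eq_sum]
  have h4 : d% (fieldInChart I x (frameField e (c t))) x (frameField e (c t) x)
      = ∑ i, c t i • d% (F i) x (frameField e (c t) x) := by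
    have h := HasMFDerivAt.sum (t := Finset.univ) (f := fun i ↦ c t i • F i)
      fun i _ ↦ (hF i).hasMFDerivAt.const_smul (c t i)
    rw [fieldInChart_frameField_eq_sum]
    have h5 : (fun p ↦ ∑ i, c t i • F i p) = ∑ i, c t i • F i := by
      funext p
      simp
    have h6 := congrArg (fun L : E →L[ℝ] E ↦ L (frameField e (c t) x : E)) (h5 ▸ h).mfderiv
    have h7 (A : Fin n → E →L[ℝ] E) (w : E) : (∑ i, c t i • A i) w = ∑ i, c t i • A i w := by
      simp
    exact h6.trans (h7 _ _)
  rw [h3, h4, fieldInChart_frameField_eq_sum e x c', ← Finset.sum_add_distrib]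
  refine h2.congr_deriv (Finset.sum_congr rfl fun i _ ↦ ?_)
  exact add_comm _ _

variable [FiniteDimensional ℝ E]

namespace PseudoRiemannianMetric

/-- The covariant acceleration of a curve in terms of the components of its velocity in the left
invariant frame. -/
theorem covAcceleration_eq_frameField (g : PseudoRiemannianMetric I G) {γ : ℝ → G}
    {c : ℝ → Fin n → ℝ} {c' : Fin n → ℝ} {t : ℝ}
    (hγ : ∀ᶠ s in nhds t, HasMFDerivAt 𝓘(ℝ, ℝ) I γ s
      (ContinuousLinearMap.toSpanSingleton ℝ (frameField e (c s) (γ s))))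
    (hc : HasDerivAt c c' t) :
    g.covAcceleration γ t = frameField e
      (c' + g.connectionForm e (γ t) (frameField e (c t) (γ t)) *ᵥ c t) (γ t) := by
  have hd := hγ.self_of_nhds
  have h1 : deriv (extChartAt I (γ t) ∘ γ)
      =ᶠ[nhds t] fun s ↦ fieldInChart I (γ t) (frameField e (c s)) (γ s) := by
    filter_upwards [hγ, hd.continuousAt.eventually
      (extChartAt_source_mem_nhds (I := I) (γ t))] with s hs hs'
    refine (hs.hasDerivAt_extChartAt_comp hs').deriv.trans ?_
    exact congrArg (tangentCoordChange I (γ s) (γ t) (γ s)) (one_smul ℝ _)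
  have h2 := (hasDerivAt_fieldInChart_frameField e hd hc).deriv
  have h3 := g.leviCivita.inChart_eq_mvfderiv_add (mdifferentiableAt_frameField e (c t) (γ t))
    (frameField e (c t) (γ t))
  have h4 : g.leviCivita.inChart (frameField e (c t)) (γ t) (frameField e (c t) (γ t))
      = frameField e (g.connectionForm e (γ t) (frameField e (c t) (γ t)) *ᵥ c t) (γ t) :=
    leviCivita_frameField _ _ _
  have h5 : deriv (extChartAt I (γ t) ∘ γ) t = frameField e (c t) (γ t) :=
    h1.eq_of_nhds.trans (fieldInChart_self _ _)
  rw [g.covAcceleration_eq hd.mdifferentiableAt, h1.deriv_eq, h2, h5, fieldInChart_self]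
  refine (add_assoc (G := E) _ _ _).trans ?_
  refine Eq.trans (congrArg (fun z : E ↦ (show E from frameField e c' (γ t)) + z) (h3.symm.trans h4)) ?_
  exact (map_add (frameAt e (γ t)) _ _).symm

end PseudoRiemannianMetric

/-- Local existence of curves on a Lie group whose velocity has components `c` in the left invariant
frame, where `c` solves an autonomous differential equation. -/
theorem exists_curve_frameField [I.Boundaryless] (e : Module.Basis (Fin n) ℝ (GroupLieAlgebra I G))
    {P : (Fin n → ℝ) → (Fin n → ℝ)}
    (hP : ContDiff ℝ 1 P) (x : G) (c₀ : Fin n → ℝ) :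
    ∃ (γ : ℝ → G) (c : ℝ → Fin n → ℝ) (J : Set ℝ), IsOpen J ∧ IsPreconnected J ∧ 0 ∈ J ∧
      γ 0 = x ∧ c 0 = c₀ ∧ ContMDiffOn 𝓘(ℝ, ℝ) I 2 γ J ∧ ∀ s ∈ J,
        HasMFDerivAt 𝓘(ℝ, ℝ) I γ s
          (ContinuousLinearMap.toSpanSingleton ℝ (frameField e (c s) (γ s))) ∧
        HasDerivAt c (P (c s)) s := by
  let F (y : E × (Fin n → ℝ)) : E × (Fin n → ℝ) :=
    (∑ i, y.2 i • fieldInChart I x (frameField e (Pi.single i 1)) ((extChartAt I x).symm y.1),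
      P y.2)
  have hF : ContDiffAt ℝ 1 F (extChartAt I x x, c₀) := by
    refine ContDiffAt.prodMk (ContDiffAt.sum fun i _ ↦ ContDiffAt.smul ?_ ?_) ?_
    · fun_prop
    · have h := (contMDiffAt_iff.1 ((contMDiff_frameField e (Pi.single i 1)).contMDiffAt (x := x))).2
      rw [I.range_eq_univ, contDiffWithinAt_univ] at h
      have h' : ContDiffAt ℝ 1 (fun y : E ↦
          fieldInChart I x (frameField e (Pi.single i 1)) ((extChartAt I x).symm y))
          (extChartAt I x x) := h.snd.of_le (by norm_num)
      exact h'.comp (extChartAt I x x, c₀) contDiffAt_fst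
    · exact hP.contDiffAt.comp _ contDiffAt_snd
  obtain ⟨f, hf0, ε, hε, hf⟩ :=
    hF.exists_forall_mem_closedBall_exists_eq_forall_mem_Ioo_hasDerivAt₀ 0
  have hf0' : HasDerivAt f (F (f 0)) 0 := hf 0 ⟨by linarith, by linarith⟩
  have h1 : ∀ᶠ s in nhds (0 : ℝ), ContDiffAt ℝ 1 F (f s) ∧ (f s).1 ∈ (extChartAt I x).target := by
    refine (hf0'.continuousAt.eventually ?_).and
      ((continuous_fst.continuousAt.comp hf0'.continuousAt).eventually ?_)
    · rw [hf0]
      exact hF.eventually (by simp)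
    · rw [Function.comp_apply, hf0]
      exact extChartAt_target_mem_nhds x
  obtain ⟨δ, hδ, h1⟩ := Metric.eventually_nhds_iff_ball.1 h1
  set J : Set ℝ := Metric.ball 0 (min ε δ)
  have hJ : IsOpen J := Metric.isOpen_ball
  have hJf : ∀ s ∈ J, HasDerivAt f (F (f s)) s := fun s hs ↦ hf s <| by
    have := Metric.ball_subset_ball (min_le_left ε δ) hs
    rwa [Real.ball_eq_Ioo] at this
  have hJ1 : ∀ s ∈ J, ContDiffAt ℝ 1 F (f s) ∧ (f s).1 ∈ (extChartAt I x).target :=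
    fun s hs ↦ h1 s (Metric.ball_subset_ball (min_le_right ε δ) hs)
  have hstep (k : ℕ) (hk : k ≤ 1) (hfk : ContDiffOn ℝ k f J) : ContDiffOn ℝ (k + 1) f J := by
    rw [contDiffOn_succ_iff_deriv_of_isOpen hJ]
    refine ⟨fun s hs ↦ (hJf s hs).differentiableAt.differentiableWithinAt, by simp, ?_⟩
    refine ContDiffOn.congr (f := F ∘ f) (fun s hs ↦ ?_) fun s hs ↦ (hJf s hs).deriv
    exact ((hJ1 s hs).1.of_le (by exact_mod_cast hk)).comp_contDiffWithinAt s (hfk s hs)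
  have hf2 : ContDiffOn ℝ 2 f J := by
    have h0 : ContDiffOn ℝ (0 : ℕ) f J := by
      rw [Nat.cast_zero, contDiffOn_zero]
      exact fun s hs ↦ (hJf s hs).continuousAt.continuousWithinAt
    have h1 := hstep 1 le_rfl (by simpa using hstep 0 zero_le_one h0)
    norm_num at h1
    exact h1
  refine ⟨fun s ↦ (extChartAt I x).symm (f s).1, fun s ↦ (f s).2, J, hJ,
    (convex_ball _ _).isPreconnected, Metric.mem_ball_self (lt_min hε hδ), ?_, ?_, ?_, ?_⟩
  · simp [hf0]
  · simp [hf0]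
  · exact (contMDiffOn_extChartAt_symm (n := 2) x).comp hf2.fst.contMDiffOn fun s hs ↦ (hJ1 s hs).2
  · intro s hs
    refine ⟨HasDerivAt.hasMFDerivAt_extChartAt_symm_comp (hJ1 s hs).2 ?_, (hJf s hs).snd⟩
    have hfst : HasDerivAt (fun s ↦ (f s).1) (F (f s)).1 s := (hJf s hs).fst
    refine hfst.congr_deriv ?_
    have h := congrFun (fieldInChart_frameField_eq_sum e x (f s).2) ((extChartAt I x).symm (f s).1)
    refine h.symm.trans ?_
    exact congrArg (tangentCoordChange I _ x _) (one_smul ℝ _).symm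

end Geodesics

section GeodesicEquivalence

variable {E : Type*} [NormedAddCommGroup E] [NormedSpace ℝ E] [FiniteDimensional ℝ E]
  {H : Type*} [TopologicalSpace H] {I : ModelWithCorners ℝ E H}
  {G : Type*} [TopologicalSpace G] [ChartedSpace H G] [Group G] [LieGroup I ∞ G]
  {n : ℕ} {e : Module.Basis (Fin n) ℝ (GroupLieAlgebra I G)}

namespace PseudoRiemannianMetric

variable {g g' : PseudoRiemannianMetric I G}

/-- The connection form of a left invariant metric is left invariant. -/
theorem connectionForm_frameField (hg : g.IsLeftInvariant) (x : G) (c : Fin n → ℝ) :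
    g.connectionForm e x (frameField e c x) = g.connectionForm e 1 (frameField e c 1) := by
  rw [← sub_eq_zero]
  refine Matrix.eq_zero_of_skew_of_symm (g.isUnit_det_matrix (e := e)) matrix_transpose
    (D := fun c ↦ g.connectionForm e x (frameField e c x)
      - g.connectionForm e 1 (frameField e c 1)) (fun u ↦ ?_) (fun u v ↦ ?_) c
  · have h1 := matrix_mul_connectionForm_add (e := e) hg x (frameField e u x)
    have h2 := matrix_mul_connectionForm_add (e := e) hg 1 (frameField e u 1)
    rw [Matrix.mul_sub, Matrix.transpose_sub, Matrix.sub_mul, sub_add_sub_comm, h1, h2, sub_zero]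
  · have h1 := connectionForm_mulVec_sub (e := e) (g := g) x u v
    have h2 := connectionForm_mulVec_sub (e := e) (g := g) 1 u v
    rw [Matrix.sub_mulVec, Matrix.sub_mulVec, sub_eq_sub_iff_sub_eq_sub, h1, h2]

theorem contDiff_connectionForm_mulVec (g : PseudoRiemannianMetric I G) (x : G) :
    ContDiff ℝ 1 fun c : Fin n → ℝ ↦ g.connectionForm e x (frameField e c x) *ᵥ c := by
  rw [contDiff_pi]
  intro j
  change ContDiff ℝ 1 fun c : Fin n → ℝ ↦ ∑ i, g.connectionForm e x (frameField e c x) j i * c i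
  refine ContDiff.sum fun i _ ↦ ContDiff.mul ?_ (contDiff_apply ℝ ℝ i)
  let L : (Fin n → ℝ) →ₗ[ℝ] ℝ := e.coord j ∘ₗ (leftTranslateToOne x).toLinearMap ∘ₗ
    (g.leviCivita (mulInvariantVectorField (e i)) x).toLinearMap ∘ₗ frameAt e x
  exact (LinearMap.toContinuousLinearMap L).contDiff

/-- Through every point of a Lie group, in every direction, there is a geodesic of a given left
invariant metric. -/
theorem exists_isGeodesicOn [I.Boundaryless] (hg : g.IsLeftInvariant) (x : G) (c₀ : Fin n → ℝ) :
    ∃ (γ : ℝ → G) (c : ℝ → Fin n → ℝ) (J : Set ℝ), IsOpen J ∧ IsPreconnected J ∧ 0 ∈ J ∧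
      γ 0 = x ∧ c 0 = c₀ ∧ g.IsGeodesicOn γ J ∧ ∀ s ∈ J,
        HasMFDerivAt 𝓘(ℝ, ℝ) I γ s
          (ContinuousLinearMap.toSpanSingleton ℝ (frameField e (c s) (γ s))) ∧
        HasDerivAt c (-(g.connectionForm e (γ s) (frameField e (c s) (γ s)) *ᵥ c s)) s := by
  obtain ⟨γ, c, J, hJ, hJc, h0, hγ0, hc0, hγ, h⟩ := exists_curve_frameField e
    (g.contDiff_connectionForm_mulVec (e := e) 1).neg x c₀
  have h' (s : ℝ) (hs : s ∈ J) :
      HasDerivAt c (-(g.connectionForm e (γ s) (frameField e (c s) (γ s)) *ᵥ c s)) s := by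
    rw [connectionForm_frameField hg]
    exact (h s hs).2
  refine ⟨γ, c, J, hJ, hJc, h0, hγ0, hc0, ⟨hγ, fun s hs ↦ ?_⟩, fun s hs ↦ ⟨(h s hs).1, h' s hs⟩⟩
  have h1 : ∀ᶠ r in nhds s, HasMFDerivAt 𝓘(ℝ, ℝ) I γ r
      (ContinuousLinearMap.toSpanSingleton ℝ (frameField e (c r) (γ r))) := by
    filter_upwards [hJ.mem_nhds hs] with r hr using (h r hr).1
  rw [g.covAcceleration_eq_frameField h1 (h' s hs), neg_add_cancel]
  exact map_zero (frameAt e (γ s))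

theorem image_mem_nhds {φ : ℝ → ℝ} {J : Set ℝ} {t : ℝ} (hJ : J ∈ nhds t)
    (hφ : ContDiffAt ℝ 2 φ t) (hφ' : deriv φ t ≠ 0) : φ '' J ∈ nhds (φ t) := by
  have h := (hφ.hasStrictDerivAt (by simp)).map_nhds_eq hφ'
  rw [← h]
  exact Filter.image_mem_map hJ

/-- If `g'` is geodesically equivalent to `g`, the difference of the connections maps every vector
to a multiple of itself. -/
theorem GeodesicallyEquivalent.exists_connectionForm_sub_mulVec [I.Boundaryless]
    (hg : g.IsLeftInvariant) (h : g.GeodesicallyEquivalent g') (x : G) (c : Fin n → ℝ) :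
    ∃ m : ℝ, (g'.connectionForm e x (frameField e c x) - g.connectionForm e x (frameField e c x))
      *ᵥ c = m • c := by
  obtain ⟨γ, c, J, hJ, hJc, h0, rfl, rfl, hγ, hs⟩ := exists_isGeodesicOn (e := e) hg x c
  obtain ⟨φ, γ', hφ, hφ', ⟨hγ', hγ''⟩, hγγ'⟩ := h γ J hJ hJc hγ
  have hφ0 : ContDiffAt ℝ 2 φ 0 := hφ.contDiffAt (hJ.mem_nhds h0)
  obtain ⟨m, hm⟩ := g'.covAcceleration_comp (γ := γ) hφ0 (hφ' 0 h0)
    (hγ'.contMDiffAt (image_mem_nhds (hJ.mem_nhds h0) hφ0 (hφ' 0 h0)))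
    (Filter.eventually_of_mem (hJ.mem_nhds h0) hγγ') (hγ'' _ (Set.mem_image_of_mem φ h0))
  have h1 : ∀ᶠ r in nhds (0 : ℝ), HasMFDerivAt 𝓘(ℝ, ℝ) I γ r
      (ContinuousLinearMap.toSpanSingleton ℝ (frameField e (c r) (γ r))) := by
    filter_upwards [hJ.mem_nhds h0] with r hr using (hs r hr).1
  have h2 : mfderiv 𝓘(ℝ, ℝ) I γ 0 (1 : ℝ) = frameField e (c 0) (γ 0) := by
    rw [h1.self_of_nhds.mfderiv]
    exact one_smul ℝ _
  rw [g'.covAcceleration_eq_frameField h1 (hs 0 h0).2, h2] at hm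
  refine ⟨m, ?_⟩
  rw [Matrix.sub_mulVec, sub_eq_neg_add]
  refine frameField_injective e (γ 0) (hm.trans ?_)
  exact (map_smul (frameAt e (γ 0)) m (c 0)).symm

theorem connectionForm_sub_symm (x : G) (u v : Fin n → ℝ) :
    (g'.connectionForm e x (frameField e u x) - g.connectionForm e x (frameField e u x)) *ᵥ v
      = (g'.connectionForm e x (frameField e v x) - g.connectionForm e x (frameField e v x)) *ᵥ u := by
  have h1 := connectionForm_mulVec_sub (e := e) (g := g') x u v
  have h2 := connectionForm_mulVec_sub (e := e) (g := g) x u v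
  rw [Matrix.sub_mulVec, Matrix.sub_mulVec, sub_eq_sub_iff_sub_eq_sub, h1, h2]

theorem GeodesicallyEquivalent.matrix_mem_aff [I.Boundaryless] (hg : g.IsLeftInvariant)
    (hg' : g'.IsLeftInvariant) (h : g.GeodesicallyEquivalent g') : g'.matrix e ∈ g.aff e := by
  intro x v
  have hD := Matrix.eq_zero_of_trace_of_forall_eigenvector
    (D := fun c ↦ g'.connectionForm e x (frameField e c x)
      - g.connectionForm e x (frameField e c x))
    (connectionForm_sub_symm x) (fun u ↦ ?_)
    (h.exists_connectionForm_sub_mulVec hg x) (e.equivFun (leftTranslateToOne x v))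
  · simp only [frameField_leftTranslateToOne] at hD
    rw [← sub_eq_zero.1 hD]
    exact matrix_mul_connectionForm_add hg' x v
  · rw [Matrix.trace_sub, Matrix.trace_eq_zero_of_skew g'.isUnit_det_matrix
      (matrix_mul_connectionForm_add hg' x _), Matrix.trace_eq_zero_of_skew g.isUnit_det_matrix
      (matrix_mul_connectionForm_add hg x _), sub_zero]

theorem christoffel_eq_of_matrix_mem_aff (hg' : g'.IsLeftInvariant)
    (h : g'.matrix e ∈ g.aff e) (x : G) (v : E) : g'.christoffel x v = g.christoffel x v := by
  set c : Fin n → ℝ := e.equivFun (leftTranslateToOne x (show TangentSpace I x from v))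
  have hc : frameField e c x = v := frameField_leftTranslateToOne e x _
  have hD : g'.connectionForm e x (frameField e c x) - g.connectionForm e x (frameField e c x) = 0 := by
    refine Matrix.eq_zero_of_skew_of_symm (g'.isUnit_det_matrix (e := e)) matrix_transpose
      (D := fun c ↦ g'.connectionForm e x (frameField e c x)
        - g.connectionForm e x (frameField e c x)) (fun u ↦ ?_) (connectionForm_sub_symm x) c
    have h1 := matrix_mul_connectionForm_add (e := e) hg' x (frameField e u x)
    have h2 := h x (frameField e u x)
    rw [Matrix.mul_sub, Matrix.transpose_sub, Matrix.sub_mul, sub_add_sub_comm, h1, h2, sub_zero]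
  have hY := mdifferentiableAt_frameField e c x
  have h1 := g'.leviCivita.inChart_eq_mvfderiv_add hY (frameField e c x)
  have h2 := g.leviCivita.inChart_eq_mvfderiv_add hY (frameField e c x)
  have h3 : g'.leviCivita.inChart (frameField e c) x (frameField e c x)
      = g.leviCivita.inChart (frameField e c) x (frameField e c x) := by
    unfold CovariantDerivative.inChart
    rw [leviCivita_frameField, leviCivita_frameField, sub_eq_zero.1 hD]
  rw [h1, h2, add_right_inj, hc] at h3
  exact h3

theorem covAcceleration_eq_of_matrix_mem_aff (hg' : g'.IsLeftInvariant)
    (h : g'.matrix e ∈ g.aff e) (γ : ℝ → G) (t : ℝ) :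
    g'.covAcceleration γ t = g.covAcceleration γ t :=
  congrArg (fun z : E ↦ deriv (deriv (fun s ↦ extChartAt I (γ t) (γ s))) t + z)
    (christoffel_eq_of_matrix_mem_aff hg' h (γ t) _)

end PseudoRiemannianMetric

end GeodesicEquivalence

end

theorem proposition3 {E : Type*} [NormedAddCommGroup E] [NormedSpace ℝ E] [FiniteDimensional ℝ E]
    {H : Type*} [TopologicalSpace H] (I : ModelWithCorners ℝ E H) [I.Boundaryless]
    {G : Type*} [TopologicalSpace G] [ChartedSpace H G] [Group G] [LieGroup I ∞ G]
    {n : ℕ} (e : Module.Basis (Fin n) ℝ (GroupLieAlgebra I G))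
    (g g' : PseudoRiemannianMetric I G) (hg : g.IsLeftInvariant) (hg' : g'.IsLeftInvariant) :
    g.GeodesicallyEquivalent g' ↔ g'.matrix e ∈ g.aff e := by
  refine ⟨fun h ↦ h.matrix_mem_aff hg hg', fun h γ J _ _ hγ ↦ ⟨id, γ, contDiffOn_id, ?_, ?_, ?_⟩⟩
  · simp
  · rw [Set.image_id]
    exact ⟨hγ.1, fun t ht ↦
      (PseudoRiemannianMetric.covAcceleration_eq_of_matrix_mem_aff hg' h γ t).trans (hγ.2 t ht)⟩
  · simp
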